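/- Let $1<p<\infty$, let $\mathbb D=\{z\in\mathbb C:|z|<1\}$ and let $dA=\frac{dx\,dy}{\pi}$ be the normalized area measure on $\mathbb D$. For $f$ analytic in $\mathbb D$ put $$\rho_p(f)=\left(\int_{\mathbb D}(1-|z|^2)^{p-2}|f'(z)|^p\,dA(z)\right)^{1/p}\in[0,\infty],$$ and let the Besov space $B^p$ be the set of all $f$ analytic in $\mathbb D$ with $\|f\|_{B^p}=\left(|f(0)|^p+\rho_p(f)^p\right)^{1/p}<\infty$. Let $\{a_n\}_{n=0}^\infty$ be a decreasing (that is, non-increasing) sequence of non-negative real numbers with $a_n\to 0$ as $n\to\infty$, and let $f(z)=\sum_{n=0}^\infty a_nz^n$ for $z\in\mathbb D$. Then $$f\in B^p\iff\sum_{n=1}^\infty n^{p-1}a_n^p<\infty.$$ Furthermore, there are constants $c,C\in(0,\infty)$ depending only on $p$ such that, for every such sequence $\{a_n\}$ and the corresponding $f$, $$c\sum_{n=1}^\infty n^{p-1}a_n^p\;\le\;\rho_p(f)^p\;\le\;C\sum_{n=1}^\infty n^{p-1}a_n^p ,$$ where both sides may be infinite. -/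

import Mathlib

open Filter Topology MeasureTheory
open scoped ENNReal

noncomputable section

/-- The normalized area measure `dA = dx dy / π` on the open unit disc of the complex plane
(extended by zero to `ℂ`). -/
def diskArea : Measure ℂ :=
  (ENNReal.ofReal Real.pi)⁻¹ • volume.restrict (Metric.ball (0 : ℂ) 1)

/-- The Besov seminorm
`ρ_p(f) = (∫_𝔻 (1 - |z|²)^(p-2) |f'(z)|^p dA(z))^(1/p)`, with values in `[0, ∞]`. -/
def besovRho (p : ℝ) (f : ℂ → ℂ) : ℝ≥0∞ :=
  (∫⁻ z, ENNReal.ofReal ((1 - ‖z‖ ^ 2) ^ (p - 2)) * ‖deriv f z‖ₑ ^ p ∂diskArea) ^ (1 / p)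

/-- The Besov norm `(|f(0)|^p + ρ_p(f)^p)^(1/p)`, with values in `[0, ∞]`. -/
def besovNorm (p : ℝ) (f : ℂ → ℂ) : ℝ≥0∞ :=
  (‖f 0‖ₑ ^ p + besovRho p f ^ p) ^ (1 / p)

/-- Membership in the analytic Besov space `B^p`: the function is analytic in the open unit disc
and its Besov norm is finite. Only the values of `f` in the disc matter. -/
def MemBesov (p : ℝ) (f : ℂ → ℂ) : Prop :=
  AnalyticOnNhd ℂ f (Metric.ball (0 : ℂ) 1) ∧ besovNorm p f < ∞

end

/-! By monotonicity of `a`, Cauchy condensation makes the series comparable to `∑ (2^k a_{2^k})^p`,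
so `ρ_p(f)^p` is compared with this dyadic sum.

Upper bound: cut `f'` into the blocks `2^k ≤ n < 2^(k+1)`. Summation by parts bounds a block by `4 ·
2^k a_{2^k} |z|^(2^k-1) min(2^k, 1/|1-z|)` (`norm_block_le`). In polar coordinates `|1-z| ≥ |θ|/π`,
and a weighted Hölder inequality in `k` (`tsum_mul_min_rpow_le`) moves the power `p` inside the sum.
With `β = 1 - 1/p`, the `k`-th term is then a constant times `(2^k a_{2^k})^p 2^(kβ(p-1))` times a
function of `r` with integral of order `2^(-k(p-1))` times a function of `θ` with integral at most
of order `2^(kβ)`. Since `βp = p - 1`, the powers of `2^k` cancel (`exists_lintegral_factors_le`).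

Lower bound: disjoint discs `D_k` of radius `2^(-k)/4` approach `1` along the real axis. At the
centre all terms of `f'` are non-negative, so `|f'| ≥ 4^k a_{2^k}/8` (`le_norm_deriv`). The sub-mean
value property of `|f'|^p` spreads this over `D_k`, which contributes at least a constant times
`(2^k a_{2^k})^p`. -/

/-! ### Dyadic condensation of the series -/

theorem sum_Ico_one_two_pow {M : Type*} [AddCommMonoid M] (F : ℕ → M) (K : ℕ) :
    ∑ n ∈ Finset.range (2 ^ K - 1), F (n + 1) =
      ∑ k ∈ Finset.range K, ∑ n ∈ Finset.Ico (2 ^ k) (2 ^ (k + 1)), F n := by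
  have h1 : ∀ m : ℕ, ∑ n ∈ Finset.range (m - 1), F (n + 1) = ∑ n ∈ Finset.Ico 1 m, F n := by
    intro m
    rw [Finset.sum_Ico_eq_sum_range]
    simp only [add_comm]
  rw [h1]
  induction K with
  | zero => simp
  | succ K ih =>
    rw [Finset.sum_range_succ, ← ih, Finset.sum_Ico_consecutive _ Nat.one_le_two_pow
      (Nat.pow_le_pow_right (by norm_num) (Nat.le_succ K))]

theorem tendsto_two_pow_sub_one : Tendsto (fun K : ℕ => 2 ^ K - 1) atTop atTop :=
  tendsto_atTop_mono (fun _ => Nat.le_sub_one_of_lt Nat.lt_two_pow_self) tendsto_id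

theorem tsum_dyadic_blocks (F : ℕ → ℝ≥0∞) :
    ∑' n, F (n + 1) = ∑' k : ℕ, ∑ n ∈ Finset.Ico (2 ^ k) (2 ^ (k + 1)), F n := by
  rw [ENNReal.tsum_eq_iSup_nat' tendsto_two_pow_sub_one, ENNReal.tsum_eq_iSup_nat]
  simp_rw [sum_Ico_one_two_pow]

/-- The term `(2 ^ k * a (2 ^ k)) ^ p` of the condensed series. -/
noncomputable def dyadicTerm (p : ℝ) (a : ℕ → ℝ) (k : ℕ) : ℝ≥0∞ :=
  ENNReal.ofReal (((2 : ℝ) ^ k * a (2 ^ k)) ^ p)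

theorem block_sum_le_dyadicTerm {p : ℝ} (hp : 1 < p) {a : ℕ → ℝ} (h0 : ∀ n, 0 ≤ a n)
    (ha : Antitone a) (k : ℕ) :
    ∑ n ∈ Finset.Ico (2 ^ k : ℕ) (2 ^ (k + 1)), ENNReal.ofReal ((n : ℝ) ^ (p - 1) * a n ^ p) ≤
      ENNReal.ofReal (2 ^ p) * dyadicTerm p a k := by
  have hN : (0 : ℝ) < 2 ^ k := by positivity
  have hb : ∀ n ∈ Finset.Ico (2 ^ k : ℕ) (2 ^ (k + 1)),
      ENNReal.ofReal ((n : ℝ) ^ (p - 1) * a n ^ p) ≤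
        ENNReal.ofReal ((2 * (2 : ℝ) ^ k) ^ (p - 1) * a (2 ^ k) ^ p) := by
    intro n hn
    rw [Finset.mem_Ico] at hn
    apply ENNReal.ofReal_le_ofReal
    have h2 : (n : ℝ) ≤ 2 * 2 ^ k := by
      have := hn.2.le
      rw [pow_succ, mul_comm] at this
      exact_mod_cast this
    exact mul_le_mul (Real.rpow_le_rpow (by positivity) h2 (by linarith))
      (Real.rpow_le_rpow (h0 _) (ha hn.1) (by linarith))
      (Real.rpow_nonneg (h0 _) _) (Real.rpow_nonneg (by positivity) _)
  refine (Finset.sum_le_card_nsmul _ _ _ hb).trans ?_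
  have hc : (Finset.Ico (2 ^ k) (2 ^ (k + 1))).card = 2 ^ k := by
    rw [Nat.card_Ico, pow_succ]; omega
  rw [hc, nsmul_eq_mul, dyadicTerm, ← ENNReal.ofReal_mul (by positivity),
    ← ENNReal.ofReal_natCast, ← ENNReal.ofReal_mul (by positivity)]
  apply ENNReal.ofReal_le_ofReal
  push_cast
  rw [Real.mul_rpow (by norm_num) hN.le, Real.mul_rpow hN.le (h0 _)]
  have e1 : (2 : ℝ) ^ k * ((2 : ℝ) ^ k) ^ (p - 1) = ((2 : ℝ) ^ k) ^ p := by
    conv_lhs => rw [← Real.rpow_one_add' hN.le (by linarith)]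
    congr 1; ring
  have e2 : (2 : ℝ) ^ (p - 1) ≤ 2 ^ p :=
    Real.rpow_le_rpow_of_exponent_le (by norm_num) (by linarith)
  have hA := Real.rpow_nonneg (h0 (2 ^ k)) p
  calc (2 : ℝ) ^ k * (2 ^ (p - 1) * ((2 : ℝ) ^ k) ^ (p - 1) * a (2 ^ k) ^ p)
      = 2 ^ (p - 1) * (((2 : ℝ) ^ k * ((2 : ℝ) ^ k) ^ (p - 1)) * a (2 ^ k) ^ p) := by ring
    _ = 2 ^ (p - 1) * (((2 : ℝ) ^ k) ^ p * a (2 ^ k) ^ p) := by rw [e1]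
    _ ≤ _ := by gcongr

theorem dyadicTerm_succ_le_block_sum {p : ℝ} (hp : 1 < p) {a : ℕ → ℝ} (h0 : ∀ n, 0 ≤ a n)
    (ha : Antitone a) (k : ℕ) :
    dyadicTerm p a (k + 1) ≤ ENNReal.ofReal (2 ^ p) *
      ∑ n ∈ Finset.Ico (2 ^ k : ℕ) (2 ^ (k + 1)), ENNReal.ofReal ((n : ℝ) ^ (p - 1) * a n ^ p) := by
  have hN : (0 : ℝ) < 2 ^ k := by positivity
  have hb : ∀ n ∈ Finset.Ico (2 ^ k : ℕ) (2 ^ (k + 1)),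
      ENNReal.ofReal (((2 : ℝ) ^ k) ^ (p - 1) * a (2 ^ (k + 1)) ^ p) ≤
      ENNReal.ofReal ((n : ℝ) ^ (p - 1) * a n ^ p) := by
    intro n hn
    rw [Finset.mem_Ico] at hn
    apply ENNReal.ofReal_le_ofReal
    have h2 : (2 : ℝ) ^ k ≤ n := by exact_mod_cast hn.1
    exact mul_le_mul (Real.rpow_le_rpow (by positivity) h2 (by linarith))
      (Real.rpow_le_rpow (h0 _) (ha hn.2.le) (by linarith))
      (Real.rpow_nonneg (h0 _) _) (Real.rpow_nonneg (by positivity) _)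
  refine le_trans ?_ (mul_le_mul_right (Finset.card_nsmul_le_sum _ _ _ hb) _)
  have hc : (Finset.Ico (2 ^ k) (2 ^ (k + 1))).card = 2 ^ k := by
    rw [Nat.card_Ico, pow_succ]; omega
  rw [hc, nsmul_eq_mul, dyadicTerm, ← ENNReal.ofReal_natCast,
    ← ENNReal.ofReal_mul (by positivity), ← ENNReal.ofReal_mul (by positivity)]
  apply ENNReal.ofReal_le_ofReal
  push_cast
  have e1 : (2 : ℝ) ^ k * ((2 : ℝ) ^ k) ^ (p - 1) = ((2 : ℝ) ^ k) ^ p := by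
    conv_lhs => rw [← Real.rpow_one_add' hN.le (by linarith)]
    congr 1; ring
  rw [pow_succ, mul_comm ((2 : ℝ) ^ k) 2, mul_assoc, Real.mul_rpow (by norm_num)
    (mul_nonneg hN.le (h0 _)), Real.mul_rpow hN.le (h0 _), ← e1, mul_assoc]

theorem tsum_le_tsum_dyadicTerm {p : ℝ} (hp : 1 < p) {a : ℕ → ℝ} (h0 : ∀ n, 0 ≤ a n)
    (ha : Antitone a) :
    ∑' n : ℕ, ENNReal.ofReal (((n + 1 : ℕ) : ℝ) ^ (p - 1) * a (n + 1) ^ p) ≤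
      ENNReal.ofReal (2 ^ p) * ∑' k, dyadicTerm p a k := by
  rw [tsum_dyadic_blocks fun n => ENNReal.ofReal ((n : ℝ) ^ (p - 1) * a n ^ p),
    ← ENNReal.tsum_mul_left]
  exact ENNReal.tsum_le_tsum (block_sum_le_dyadicTerm hp h0 ha)

/-- The term `k = 0` is `a 1 ^ p`, already a term of the series; every later term is controlled by
the preceding block. Hence the constant `1 + 2 ^ p`. -/
theorem tsum_dyadicTerm_le_tsum {p : ℝ} (hp : 1 < p) {a : ℕ → ℝ} (h0 : ∀ n, 0 ≤ a n)
    (ha : Antitone a) :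
    ∑' k, dyadicTerm p a k ≤ ENNReal.ofReal (1 + 2 ^ p) *
      ∑' n : ℕ, ENNReal.ofReal (((n + 1 : ℕ) : ℝ) ^ (p - 1) * a (n + 1) ^ p) := by
  rw [tsum_eq_zero_add' ENNReal.summable, ENNReal.ofReal_add (by norm_num) (by positivity),
    add_mul]
  gcongr
  · rw [ENNReal.ofReal_one, one_mul]
    refine le_trans (le_of_eq ?_) (ENNReal.le_tsum 0)
    simp [dyadicTerm]
  · rw [tsum_dyadic_blocks fun n => ENNReal.ofReal ((n : ℝ) ^ (p - 1) * a n ^ p),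
      ← ENNReal.tsum_mul_left]
    exact ENNReal.tsum_le_tsum (dyadicTerm_succ_le_block_sum hp h0 ha)

/-! ### Termwise differentiation of the power series -/

theorem hasDerivAt_tsum_pow {a : ℕ → ℝ} {M : ℝ} (hM : ∀ n, |a n| ≤ M) {z : ℂ} (hz : ‖z‖ < 1) :
    HasDerivAt (fun w : ℂ => ∑' n : ℕ, (a n : ℂ) * w ^ n)
      (∑' n : ℕ, (a n : ℂ) * (n * z ^ (n - 1))) z := by
  obtain ⟨r, hr, hr1⟩ := exists_between hz
  have hr0 : 0 < r := (norm_nonneg z).trans_lt hr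
  have hM0 : 0 ≤ M := (abs_nonneg _).trans (hM 0)
  have hs : Summable fun n : ℕ => M * (n * r ^ (n - 1)) := by
    have h := summable_pow_mul_geometric_of_norm_lt_one 1 (r := r)
      (by rwa [Real.norm_of_nonneg hr0.le])
    refine ((h.mul_right r⁻¹).congr fun n => ?_).mul_left M
    rcases n with _ | n
    · simp
    · rw [Nat.add_sub_cancel, pow_one, pow_succ r]; field_simp
  refine hasDerivAt_tsum_of_isPreconnected (t := Metric.ball (0 : ℂ) r) (y₀ := 0)
    (g := fun n w => (a n : ℂ) * w ^ n) (g' := fun n w => (a n : ℂ) * (n * w ^ (n - 1))) hs Metric.isOpen_ball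
    (convex_ball _ _).isPreconnected (fun n y _ => (hasDerivAt_pow n y).const_mul _) ?_
    (Metric.mem_ball_self hr0) ?_ (by simpa using hr)
  · intro n y hy
    have hy' : ‖y‖ ≤ r := by simpa using (Metric.mem_ball.1 hy).le
    rw [norm_mul, norm_mul, norm_pow, Complex.norm_natCast, Complex.norm_real, Real.norm_eq_abs]
    gcongr
    exact hM n
  · refine summable_of_ne_finset_zero (s := {0}) fun n hn => ?_
    rw [zero_pow (by simpa using hn), mul_zero]

theorem summable_deriv_series {a : ℕ → ℝ} {M : ℝ} (hM : ∀ n, |a n| ≤ M) {z : ℂ} (hz : ‖z‖ < 1) :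
    Summable fun n : ℕ => (n : ℂ) * a n * z ^ (n - 1) := by
  rw [← summable_nat_add_iff 1]
  have h2 : Summable fun n : ℕ => ((n + 1 : ℕ) : ℝ) * ‖z‖ ^ n := by
    have h3 := summable_pow_mul_geometric_of_norm_lt_one 1 (r := ‖z‖) (by simpa using hz)
    have h4 := summable_geometric_of_lt_one (norm_nonneg z) hz
    refine (h3.add h4).congr fun n => ?_
    push_cast; ring
  refine Summable.of_norm_bounded (h2.mul_left M) fun n => ?_
  rw [norm_mul, norm_mul, norm_pow, Complex.norm_natCast, Complex.norm_real, Real.norm_eq_abs,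
    Nat.add_sub_cancel, mul_comm (((n + 1 : ℕ) : ℝ)), mul_assoc]
  gcongr
  exact hM _

theorem hasDerivAt_of_eq_tsum {a : ℕ → ℝ} {f : ℂ → ℂ} (h0 : ∀ n, 0 ≤ a n) (ha : Antitone a)
    (hf : ∀ z ∈ Metric.ball (0 : ℂ) 1, f z = ∑' n : ℕ, (a n : ℂ) * z ^ n)
    {z : ℂ} (hz : ‖z‖ < 1) :
    HasDerivAt f (∑' n : ℕ, (n : ℂ) * a n * z ^ (n - 1)) z := by
  have h := hasDerivAt_tsum_pow (a := a) (M := a 0)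
    (fun n => by rw [abs_of_nonneg (h0 n)]; exact ha (Nat.zero_le n)) hz
  have e : ∑' n : ℕ, (a n : ℂ) * (n * z ^ (n - 1)) = ∑' n : ℕ, (n : ℂ) * a n * z ^ (n - 1) :=
    tsum_congr fun n => by ring
  rw [← e]
  refine h.congr_of_eventuallyEq ?_
  filter_upwards [Metric.isOpen_ball.mem_nhds (show z ∈ Metric.ball (0 : ℂ) 1 by simpa using hz)]
    with w hw using hf w hw

theorem hasSum_deriv {a : ℕ → ℝ} {f : ℂ → ℂ} (h0 : ∀ n, 0 ≤ a n) (ha : Antitone a)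
    (hf : ∀ z ∈ Metric.ball (0 : ℂ) 1, f z = ∑' n : ℕ, (a n : ℂ) * z ^ n)
    {z : ℂ} (hz : ‖z‖ < 1) :
    HasSum (fun n : ℕ => (n : ℂ) * a n * z ^ (n - 1)) (deriv f z) := by
  rw [(hasDerivAt_of_eq_tsum h0 ha hf hz).deriv]
  exact (summable_deriv_series (M := a 0)
    (fun n => by rw [abs_of_nonneg (h0 n)]; exact ha (Nat.zero_le n)) hz).hasSum

theorem differentiableOn_of_eq_tsum {a : ℕ → ℝ} {f : ℂ → ℂ} (h0 : ∀ n, 0 ≤ a n) (ha : Antitone a)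
    (hf : ∀ z ∈ Metric.ball (0 : ℂ) 1, f z = ∑' n : ℕ, (a n : ℂ) * z ^ n) :
     DifferentiableOn ℂ f (Metric.ball 0 1) := fun z hz =>
  (hasDerivAt_of_eq_tsum h0 ha hf
    (by simpa using hz)).differentiableAt.differentiableWithinAt

/-! ### Pointwise estimate of the derivative by dyadic blocks -/

/-- Abel summation as an induction on block length; carrying the boundary term makes each step add
exactly `z^n ((n+1) a_{n+1} - n a_n)` with `n = N + j`. This coefficient is `a_{n+1} - n (a_n -
a_{n+1})`, of size at most `a_N + 2N (a_n - a_{n+1})`, and the differences telescope. -/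
theorem norm_block_mul_one_sub_le {a : ℕ → ℝ} (h0 : ∀ n, 0 ≤ a n) (ha : Antitone a) {z : ℂ}
    (hz : ‖z‖ < 1) {N : ℕ} (hN : 0 < N) (j : ℕ) (hj : j ≤ N) :
    ‖(1 - z) * ∑ n ∈ Finset.Ico N (N + j), (n : ℂ) * a n * z ^ (n - 1) +
        (N + j : ℕ) * a (N + j) * z ^ (N + j - 1)‖ ≤
      ‖z‖ ^ (N - 1) * (N * a N + 2 * N * (a N - a (N + j)) + j * a N) := by
  induction j with
  | zero => simp [abs_of_nonneg (h0 N), mul_comm]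
  | succ j ih =>
    have ih := ih (by omega)
    obtain ⟨m, hm⟩ : ∃ m, N + j = m + 1 := ⟨N + j - 1, by omega⟩
    have e : (1 - z) * ∑ n ∈ Finset.Ico N (N + (j + 1)), (n : ℂ) * a n * z ^ (n - 1) +
        (N + (j + 1) : ℕ) * a (N + (j + 1)) * z ^ (N + (j + 1) - 1) =
      ((1 - z) * ∑ n ∈ Finset.Ico N (N + j), (n : ℂ) * a n * z ^ (n - 1) +
        (N + j : ℕ) * a (N + j) * z ^ (N + j - 1)) +
      z ^ (N + j) * (((a (N + (j + 1)) - (N + j : ℕ) * (a (N + j) - a (N + (j + 1))) : ℝ)) : ℂ) := by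
      rw [← add_assoc, Finset.sum_Ico_succ_top (by omega), hm]
      push_cast
      ring
    rw [e]
    have hd : 0 ≤ a (N + j) - a (N + (j + 1)) := sub_nonneg.2 (ha (by omega))
    have hb : |a (N + (j + 1)) - (N + j : ℕ) * (a (N + j) - a (N + (j + 1)))| ≤
        a N + 2 * N * (a (N + j) - a (N + (j + 1))) := by
      have h1 : a (N + (j + 1)) ≤ a N := ha (by omega)
      have h2 := h0 (N + (j + 1))
      have h3 : ((N + j : ℕ) : ℝ) ≤ 2 * N := by
        have : N + j ≤ 2 * N := by omega
        exact_mod_cast this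
      have h4 := mul_le_mul_of_nonneg_right h3 hd
      have h5 : 0 ≤ ((N + j : ℕ) : ℝ) * (a (N + j) - a (N + (j + 1))) := by positivity
      rw [abs_le]; constructor <;> linarith [h0 N]
    have hpow : ‖z‖ ^ (N + j) ≤ ‖z‖ ^ (N - 1) :=
      pow_le_pow_of_le_one (norm_nonneg _) hz.le (by omega)
    have h6 : ‖z ^ (N + j) *
        (((a (N + (j + 1)) - (N + j : ℕ) * (a (N + j) - a (N + (j + 1))) : ℝ)) : ℂ)‖ ≤
        ‖z‖ ^ (N - 1) * (a N + 2 * N * (a (N + j) - a (N + (j + 1)))) := by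
      rw [norm_mul, norm_pow, Complex.norm_real, Real.norm_eq_abs]
      exact mul_le_mul hpow hb (abs_nonneg _) (by positivity)
    refine (norm_add_le _ _).trans ((add_le_add ih h6).trans (le_of_eq ?_))
    push_cast
    ring

/-- The bound by `N` is the triangle inequality; the bound by `‖1 - z‖⁻¹` is the summation by parts
with `j = N`, after removing the boundary term. -/
theorem norm_block_le {a : ℕ → ℝ} (h0 : ∀ n, 0 ≤ a n) (ha : Antitone a) {z : ℂ}
    (hz : ‖z‖ < 1) {N : ℕ} (hN : 0 < N) :
    ‖∑ n ∈ Finset.Ico N (2 * N), (n : ℂ) * a n * z ^ (n - 1)‖ ≤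
      4 * (N * a N * ‖z‖ ^ (N - 1)) * min (N : ℝ) ‖1 - z‖⁻¹ := by
  have hA : 0 ≤ N * a N * ‖z‖ ^ (N - 1) := by have := h0 N; positivity
  rw [mul_min_of_nonneg _ _ (by positivity), le_min_iff]
  constructor
  · have hb : ∀ n ∈ Finset.Ico N (2 * N), ‖(n : ℂ) * a n * z ^ (n - 1)‖ ≤
        2 * N * a N * ‖z‖ ^ (N - 1) := by
      intro n hn
      rw [Finset.mem_Ico] at hn
      rw [norm_mul, norm_mul, norm_pow, Complex.norm_natCast, Complex.norm_real,
        Real.norm_of_nonneg (h0 n)]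
      have h2 : (n : ℝ) ≤ 2 * N := by exact_mod_cast hn.2.le
      exact mul_le_mul (mul_le_mul h2 (ha hn.1) (h0 _) (by positivity))
        (pow_le_pow_of_le_one (norm_nonneg _) hz.le (by omega)) (by positivity)
        (by have := h0 N; positivity)
    refine (norm_sum_le_of_le _ hb).trans ?_
    rw [Finset.sum_const, Nat.card_Ico, nsmul_eq_mul]
    have : ((2 * N - N : ℕ) : ℝ) = N := by rw [two_mul, Nat.add_sub_cancel]
    rw [this]
    nlinarith
  · have h1 : 0 < ‖1 - z‖ := by
      rw [norm_pos_iff, sub_ne_zero]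
      rintro rfl
      simp at hz
    rw [← div_eq_mul_inv, le_div_iff₀ h1, mul_comm, ← norm_mul, two_mul]
    have h := norm_block_mul_one_sub_le h0 ha hz hN N le_rfl
    have h2 : ‖((N + N : ℕ) : ℂ) * a (N + N) * z ^ (N + N - 1)‖ ≤
        ‖z‖ ^ (N - 1) * (2 * N * a (N + N)) := by
      rw [norm_mul, norm_mul, norm_pow, Complex.norm_natCast, Complex.norm_real,
        Real.norm_of_nonneg (h0 _), mul_comm, ← two_mul]
      push_cast
      have := h0 (2 * N)
      exact mul_le_mul_of_nonneg_right
        (pow_le_pow_of_le_one (norm_nonneg _) hz.le (by omega)) (by positivity)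
    have h3 := norm_le_add_norm_add ((1 - z) * ∑ n ∈ Finset.Ico N (N + N), (n : ℂ) * a n * z ^ (n - 1))
      (((N + N : ℕ) : ℂ) * a (N + N) * z ^ (N + N - 1))
    refine h3.trans ((add_le_add h h2).trans (le_of_eq ?_))
    ring

theorem enorm_deriv_le {a : ℕ → ℝ} {f : ℂ → ℂ} (h0 : ∀ n, 0 ≤ a n) (ha : Antitone a)
    (hf : ∀ z ∈ Metric.ball (0 : ℂ) 1, f z = ∑' n : ℕ, (a n : ℂ) * z ^ n)
    {z : ℂ} (hz : ‖z‖ < 1) :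
    ‖deriv f z‖ₑ ≤ ∑' k : ℕ, ENNReal.ofReal
      (4 * ((2 : ℝ) ^ k * a (2 ^ k) * ‖z‖ ^ (2 ^ k - 1)) * min ((2 : ℝ) ^ k) ‖1 - z‖⁻¹) := by
  have h := (hasSum_deriv h0 ha hf hz).tendsto_sum_nat.comp
    (tendsto_pow_atTop_atTop_of_one_lt one_lt_two)
  refine le_of_tendsto h.enorm (Eventually.of_forall fun K => ?_)
  have e : ∑ n ∈ Finset.range (2 ^ K), (n : ℂ) * a n * z ^ (n - 1) =
      ∑ k ∈ Finset.range K, ∑ n ∈ Finset.Ico (2 ^ k : ℕ) (2 ^ (k + 1)),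
        (n : ℂ) * a n * z ^ (n - 1) := by
    rw [← sum_Ico_one_two_pow fun n : ℕ => (n : ℂ) * a n * z ^ (n - 1)]
    -- The term `n = 0` is split off; its factor `n` makes it vanish.
    conv_lhs => rw [← Nat.sub_add_cancel (Nat.one_le_two_pow (n := K)), Finset.sum_range_succ']
    simp
  simp only [Function.comp_apply]
  rw [e]
  refine (enorm_sum_le _ _).trans (le_trans (Finset.sum_le_sum fun k _ => ?_)
    (ENNReal.sum_le_tsum (Finset.range K)))
  rw [← ofReal_norm]
  apply ENNReal.ofReal_le_ofReal
  have hb := norm_block_le h0 ha hz (N := 2 ^ k) (by positivity)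
  rw [pow_succ, mul_comm (2 ^ k) 2]
  exact_mod_cast hb

/-- The squared distance is `(r - cos θ)² + sin² θ`. For `|θ| ≤ π/2` Jordan's inequality bounds
`|sin θ|` below; otherwise `cos θ ≤ 0` and the distance is at least `1`. -/
theorem abs_div_pi_le_norm_one_sub (r θ : ℝ) (hr : 0 ≤ r) (hθ : |θ| ≤ Real.pi) :
    |θ| / Real.pi ≤ ‖1 - (r : ℂ) * (Real.cos θ + Real.sin θ * Complex.I)‖ := by
  have hπ := Real.pi_pos
  have hsq : ‖1 - (r : ℂ) * (Real.cos θ + Real.sin θ * Complex.I)‖ ^ 2 =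
      1 - 2 * r * Real.cos θ + r ^ 2 := by
    rw [← Complex.normSq_eq_norm_sq, Complex.normSq_apply]
    simp
    rw [Complex.cos_ofReal_re, Complex.sin_ofReal_re]
    nlinarith [Real.sin_sq_add_cos_sq θ]
  refine le_of_sq_le_sq ?_ (norm_nonneg _)
  rw [hsq]
  rcases le_total |θ| (Real.pi / 2) with h | h
  · have h1 := Real.mul_abs_le_abs_sin h
    have h2 : |θ| / Real.pi ≤ |Real.sin θ| := by
      refine le_trans ?_ h1
      rw [div_eq_inv_mul, div_eq_mul_inv]
      have : 0 ≤ Real.pi⁻¹ * |θ| := by positivity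
      linarith
    have h3 : (|θ| / Real.pi) ^ 2 ≤ Real.sin θ ^ 2 := by
      rw [← sq_abs (Real.sin θ)]
      exact pow_le_pow_left₀ (by positivity) h2 2
    nlinarith [Real.sin_sq_add_cos_sq θ, sq_nonneg (r - Real.cos θ)]
  · have h1 : Real.cos θ ≤ 0 := by
      rw [← Real.cos_abs]
      exact Real.cos_nonpos_of_pi_div_two_le_of_le h (by linarith)
    have h2 : |θ| / Real.pi ≤ 1 := by rwa [div_le_one hπ]
    have h3 : (|θ| / Real.pi) ^ 2 ≤ 1 := pow_le_one₀ (by positivity) h2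
    nlinarith [mul_nonneg hr (neg_nonneg.2 h1), sq_nonneg r]

/-! ### Weighted Hölder inequality over the dyadic scales -/

theorem tsum_weight_mul_rpow_le {ι : Type*} {p : ℝ} (hp : 1 ≤ p) (w g : ι → ℝ≥0∞) :
    (∑' k, w k * g k) ^ p ≤ (∑' k, w k) ^ (p - 1) * ∑' k, w k * g k ^ p := by
  have hp0 : 0 < p := by linarith
  have h : ∑' k, w k * g k ≤ (∑' k, w k) ^ (1 - p⁻¹) * (∑' k, w k * g k ^ p) ^ p⁻¹ := by
    rw [ENNReal.tsum_eq_iSup_sum]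
    refine iSup_le fun s => (ENNReal.inner_le_weight_mul_Lp_of_nonneg s hp w g).trans ?_
    have hp1 : 0 ≤ 1 - p⁻¹ := sub_nonneg.2 (inv_le_one_of_one_le₀ hp)
    gcongr
    · exact ENNReal.sum_le_tsum s
    · exact ENNReal.sum_le_tsum s
  refine (ENNReal.rpow_le_rpow h hp0.le).trans (le_of_eq ?_)
  rw [ENNReal.mul_rpow_of_nonneg _ _ hp0.le, ← ENNReal.rpow_mul, ← ENNReal.rpow_mul,
    inv_mul_cancel₀ hp0.ne', ENNReal.rpow_one, sub_mul, one_mul, inv_mul_cancel₀ hp0.ne']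

/-- The summand is `2^(ks)` while `2^k ≤ 1/T` and `T⁻¹ 2^(-k(1-s))` afterwards: geometric growth,
then geometric decay, both dominated by the crossover value `T^(-s)`. -/
theorem tsum_min_two_pow_le {s : ℝ} (hs0 : 0 < s) (hs1 : s < 1) :
    ∃ A : ℝ, 0 < A ∧ ∀ T : ℝ, 0 < T →
      ∑' k : ℕ, ENNReal.ofReal (min ((2 : ℝ) ^ k) T⁻¹ * ((2 : ℝ) ^ k) ^ (-(1 - s))) ≤
        ENNReal.ofReal (A * T ^ (-s)) := by
  set ρ : ℝ := 2 ^ s with hρ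
  set σ : ℝ := 2 ^ (-(1 - s)) with hσ
  have hρ1 : 1 < ρ := Real.one_lt_rpow (by norm_num) hs0
  have hσ0 : 0 < σ := by positivity
  have hσ1 : σ < 1 := Real.rpow_lt_one_of_one_lt_of_neg (by norm_num) (by linarith)
  have hpow : ∀ (t : ℝ) (k : ℕ), ((2 : ℝ) ^ k) ^ t = ((2 : ℝ) ^ t) ^ k := by
    intro t k
    rw [← Real.rpow_natCast, ← Real.rpow_natCast, ← Real.rpow_mul (by norm_num),
      ← Real.rpow_mul (by norm_num), mul_comm]
  refine ⟨ρ / (ρ - 1) + (1 - σ)⁻¹, ?_, fun T hT => ?_⟩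
  · have : 0 < ρ - 1 := by linarith
    have : 0 < 1 - σ := by linarith
    positivity
  have hex : ∃ K : ℕ, T⁻¹ ≤ 2 ^ K :=
    (pow_unbounded_of_one_lt T⁻¹ one_lt_two).imp fun _ h => h.le
  classical
  set K := Nat.find hex with hK
  have hK1 : T⁻¹ ≤ 2 ^ K := Nat.find_spec hex
  -- If `K = 0` the left side is zero; otherwise minimality of `K` gives `2^(K-1) < 1/T`.
  have hρK : ρ ^ K - 1 ≤ ρ * T ^ (-s) := by
    rcases Nat.eq_zero_or_pos K with h | h
    · rw [h]; simp; positivity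
    · have h2 : (2 : ℝ) ^ (K - 1) < T⁻¹ := not_le.1 (Nat.find_min hex (Nat.sub_lt h one_pos))
      have h3 : ρ ^ (K - 1) ≤ T ^ (-s) := by
        rw [Real.rpow_neg hT.le, ← Real.inv_rpow hT.le, hρ, ← hpow]
        exact Real.rpow_le_rpow (by positivity) h2.le hs0.le
      have h4 : ρ ^ K = ρ * ρ ^ (K - 1) := by rw [← pow_succ', Nat.sub_add_cancel h]
      rw [h4]
      have := mul_le_mul_of_nonneg_left h3 (by linarith : (0 : ℝ) ≤ ρ)
      linarith
  have hTs : 0 < T ^ (-s) := by positivity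
  rw [← ENNReal.summable.sum_add_tsum_nat_add' (k := K), add_mul,
    ENNReal.ofReal_add (by have : 0 < ρ - 1 := by linarith
                           positivity)
      (by have : 0 < 1 - σ := by linarith
          positivity)]
  refine add_le_add ?_ ?_
  · rw [← ENNReal.ofReal_sum_of_nonneg (fun _ _ => by positivity)]
    apply ENNReal.ofReal_le_ofReal
    have hb : ∀ k ∈ Finset.range K, min ((2 : ℝ) ^ k) T⁻¹ * ((2 : ℝ) ^ k) ^ (-(1 - s)) ≤ ρ ^ k := by
      intro k _
      refine (mul_le_mul_of_nonneg_right (min_le_left _ _) (by positivity)).trans (le_of_eq ?_)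
      rw [hρ, ← hpow]
      conv_lhs => rw [← Real.rpow_one_add' (by positivity) (by linarith)]
      congr 1; ring
    refine (Finset.sum_le_sum hb).trans ?_
    rw [geom_sum_eq hρ1.ne', div_mul_eq_mul_div]
    exact div_le_div_of_nonneg_right hρK (by linarith)
  · have hb : ∀ k : ℕ, ENNReal.ofReal
        (min ((2 : ℝ) ^ (k + K)) T⁻¹ * ((2 : ℝ) ^ (k + K)) ^ (-(1 - s))) ≤
        ENNReal.ofReal (T ^ (-s) * σ ^ k) := by
      intro k
      apply ENNReal.ofReal_le_ofReal
      have h1 : ((2 : ℝ) ^ K) ^ (-(1 - s)) ≤ T⁻¹ ^ (-(1 - s)) :=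
        Real.rpow_le_rpow_of_nonpos (by positivity) hK1 (by linarith)
      have h2 : T⁻¹ * T⁻¹ ^ (-(1 - s)) = T ^ (-s) := by
        conv_lhs => rw [← Real.rpow_one_add' (by positivity) (by linarith)]
        rw [Real.inv_rpow hT.le, ← Real.rpow_neg hT.le]
        congr 1; ring
      rw [pow_add, Real.mul_rpow (by positivity) (by positivity), ← h2, hσ, ← hpow]
      calc _ ≤ T⁻¹ * (((2 : ℝ) ^ k) ^ (-(1 - s)) * ((2 : ℝ) ^ K) ^ (-(1 - s))) :=
            mul_le_mul_of_nonneg_right (min_le_right _ _) (by positivity)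
        _ ≤ T⁻¹ * (((2 : ℝ) ^ k) ^ (-(1 - s)) * T⁻¹ ^ (-(1 - s))) := by gcongr
        _ = _ := by ring
    refine (ENNReal.tsum_le_tsum hb).trans ?_
    rw [← ENNReal.ofReal_tsum_of_nonneg (fun _ => by positivity)
      ((summable_geometric_of_lt_one hσ0.le hσ1).mul_left _), tsum_mul_left,
      tsum_geometric_of_lt_one hσ0.le hσ1, mul_comm]

/-- Hölder with weights `min(2^k, 1/T) 2^(-kβ)`, `β = 1 - 1/p`. Their sum is `O(T^(-1/p))`, whose
power `p - 1` is `O(T^(-β))`. Removing the weight from `c k` costs `2^(kβp)`, leaving the net factor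
`2^(kβ(p-1))`. -/
theorem tsum_mul_min_rpow_le {p : ℝ} (hp : 1 < p) :
    ∃ A : ℝ, 0 < A ∧ ∀ (c : ℕ → ℝ≥0∞) (T : ℝ), 0 < T →
      (∑' k : ℕ, c k * ENNReal.ofReal (min ((2 : ℝ) ^ k) T⁻¹)) ^ p ≤
        ENNReal.ofReal A * ∑' k : ℕ, c k ^ p * ENNReal.ofReal (((2 : ℝ) ^ k) ^ ((1 - p⁻¹) * (p - 1)))
          * ENNReal.ofReal (min ((2 : ℝ) ^ k) T⁻¹ * T ^ (-(1 - p⁻¹))) := by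
  have hp0 : 0 < p := by linarith
  obtain ⟨A, hA, h⟩ := tsum_min_two_pow_le (inv_pos.2 hp0) (inv_lt_one_of_one_lt₀ hp)
  refine ⟨A ^ (p - 1), by positivity, fun c T hT => ?_⟩
  set β := 1 - p⁻¹ with hβ
  have hmin : ∀ k : ℕ, 0 < min ((2 : ℝ) ^ k) T⁻¹ := fun k => lt_min (by positivity) (by positivity)
  have e1 : ∀ k : ℕ, c k * ENNReal.ofReal (min ((2 : ℝ) ^ k) T⁻¹) =
      ENNReal.ofReal (min ((2 : ℝ) ^ k) T⁻¹ * ((2 : ℝ) ^ k) ^ (-β)) *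
        (c k * ENNReal.ofReal (((2 : ℝ) ^ k) ^ β)) := by
    intro k
    rw [mul_left_comm, ← ENNReal.ofReal_mul (by have := hmin k; positivity), mul_assoc,
      ← Real.rpow_add (by positivity), neg_add_cancel, Real.rpow_zero, mul_one]
  simp_rw [e1]
  refine (tsum_weight_mul_rpow_le hp.le _ _).trans ?_
  have h2 : (∑' k : ℕ, ENNReal.ofReal (min ((2 : ℝ) ^ k) T⁻¹ * ((2 : ℝ) ^ k) ^ (-β))) ^ (p - 1) ≤
      ENNReal.ofReal (A ^ (p - 1)) * ENNReal.ofReal (T ^ (-β)) := by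
    refine (ENNReal.rpow_le_rpow (h T hT) (by linarith)).trans (le_of_eq ?_)
    rw [ENNReal.ofReal_rpow_of_nonneg (by positivity) (by linarith),
      Real.mul_rpow hA.le (by positivity), ← Real.rpow_mul hT.le,
      ENNReal.ofReal_mul (by positivity)]
    congr 3
    rw [hβ]; field_simp
  refine (mul_le_mul_left h2 _).trans (le_of_eq ?_)
  rw [mul_assoc, ← ENNReal.tsum_mul_left]
  congr 1
  refine tsum_congr fun k => ?_
  rw [ENNReal.mul_rpow_of_nonneg _ _ hp0.le, ENNReal.ofReal_rpow_of_nonneg (by positivity) hp0.le,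
    ← Real.rpow_mul (by positivity)]
  have e3 : ((2 : ℝ) ^ k) ^ (β * (p - 1)) = ((2 : ℝ) ^ k) ^ (-β) * ((2 : ℝ) ^ k) ^ (β * p) := by
    rw [← Real.rpow_add (by positivity)]; congr 1; ring
  rw [e3, ENNReal.ofReal_mul (hmin k).le, ENNReal.ofReal_mul (by positivity),
    ENNReal.ofReal_mul (hmin k).le]
  ring

/-! ### Radial and angular integrals in one variable -/

theorem lintegral_rpow_mul_exp_neg {s b : ℝ} (hs : 0 < s) (hb : 0 < b) :
    ∫⁻ x in Set.Ioi (0 : ℝ), ENNReal.ofReal (x ^ (s - 1) * Real.exp (-(b * x))) =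
      ENNReal.ofReal ((1 / b) ^ s * Real.Gamma s) := by
  rw [← Real.integral_rpow_mul_exp_neg_mul_Ioi hs hb, ofReal_integral_eq_lintegral_ofReal]
  · have h := integrableOn_rpow_mul_exp_neg_mul_rpow (s := s - 1) (by linarith) one_pos hb
    simpa [IntegrableOn] using h
  · filter_upwards [ae_restrict_mem measurableSet_Ioi] with x hx
    have hx : (0 : ℝ) < x := hx
    positivity

theorem lintegral_comp_abs_le (h : ℝ → ℝ≥0∞) :
    ∫⁻ x, h |x| ≤ 2 * ∫⁻ x in Set.Ioi 0, h x := by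
  have h1 : ∫⁻ x in Set.Ioi (0 : ℝ), h |x| = ∫⁻ x in Set.Ioi 0, h x :=
    setLIntegral_congr_fun measurableSet_Ioi fun x hx => by rw [abs_of_pos hx]
  have h2 : ∫⁻ x in Set.Iio (0 : ℝ), h |x| = ∫⁻ x in Set.Ioi 0, h x := by
    rw [← h1]
    have := (Measure.measurePreserving_neg (volume : Measure ℝ)).setLIntegral_comp_preimage_emb
      (MeasurableEquiv.neg ℝ).measurableEmbedding (fun x => h |x|) (Set.Ioi 0)
    simpa using this
  have h3 : ∫⁻ x, h |x| = (∫⁻ x in Set.Iio (0 : ℝ), h |x|) + ∫⁻ x in Set.Ici (0 : ℝ), h |x| := by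
    rw [← Set.compl_Iio]; exact (lintegral_add_compl _ measurableSet_Iio).symm
  rw [h3, h2, setLIntegral_congr (Ioi_ae_eq_Ici (μ := volume) (a := (0 : ℝ))).symm, h1, two_mul]

/-- Split at `|t| = 1/N`: `N t^(-β)` is integrable near `0` because `β < 1`, and `t^(-1-β)` near
infinity because `β > 0`. -/
theorem lintegral_min_mul_rpow_le {β : ℝ} (hβ0 : 0 < β) (hβ1 : β < 1) {N : ℝ} (hN : 0 < N) :
    ∫⁻ t : ℝ, ENNReal.ofReal (min N |t|⁻¹ * |t| ^ (-β)) ≤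
      ENNReal.ofReal (2 * (1 / (1 - β) + 1 / β) * N ^ β) := by
  have hN' : 0 < N⁻¹ := inv_pos.2 hN
  refine (lintegral_comp_abs_le fun t => ENNReal.ofReal (min N t⁻¹ * t ^ (-β))).trans ?_
  rw [mul_assoc, ENNReal.ofReal_mul (by norm_num), ENNReal.ofReal_ofNat]
  gcongr
  have hsplit : Set.Ioi (0 : ℝ) = Set.Ioc 0 N⁻¹ ∪ Set.Ioi N⁻¹ :=
    (Set.Ioc_union_Ioi_eq_Ioi hN'.le).symm
  have hA : ∫⁻ t in Set.Ioc 0 N⁻¹, ENNReal.ofReal (min N t⁻¹ * t ^ (-β)) ≤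
      ENNReal.ofReal (1 / (1 - β) * N ^ β) := by
    have hint : IntegrableOn (fun t : ℝ => N * t ^ (-β)) (Set.Ioc 0 N⁻¹) :=
      ((intervalIntegrable_iff_integrableOn_Ioc_of_le hN'.le).1
        (intervalIntegral.intervalIntegrable_rpow' (by linarith))).const_mul N
    have hval : ∫ t in Set.Ioc 0 N⁻¹, N * t ^ (-β) = 1 / (1 - β) * N ^ β := by
      rw [integral_const_mul, ← intervalIntegral.integral_of_le hN'.le,
        integral_rpow (Or.inl (by linarith)), Real.zero_rpow (by linarith), sub_zero,
        Real.inv_rpow hN.le, ← Real.rpow_neg hN.le]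
      have : N ^ β = N * N ^ (-(-β + 1)) := by
        conv_rhs => rw [← Real.rpow_one_add' hN.le (by linarith)]
        congr 1; ring
      rw [this, neg_add_eq_sub]; ring
    rw [← hval, ofReal_integral_eq_lintegral_ofReal hint]
    · refine setLIntegral_mono' measurableSet_Ioc fun t ht => ENNReal.ofReal_le_ofReal ?_
      exact mul_le_mul_of_nonneg_right (min_le_left _ _) (Real.rpow_nonneg ht.1.le _)
    · filter_upwards [ae_restrict_mem measurableSet_Ioc] with t ht
      have := Real.rpow_nonneg ht.1.le (-β)
      positivity
  have hB : ∫⁻ t in Set.Ioi N⁻¹, ENNReal.ofReal (min N t⁻¹ * t ^ (-β)) ≤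
      ENNReal.ofReal (1 / β * N ^ β) := by
    have hval : ∫ t in Set.Ioi N⁻¹, t ^ (-β - 1) = 1 / β * N ^ β := by
      rw [integral_Ioi_rpow_of_lt (by linarith) hN', sub_add_cancel, Real.inv_rpow hN.le,
        ← Real.rpow_neg hN.le, neg_neg]
      field_simp
    rw [← hval, ofReal_integral_eq_lintegral_ofReal
      (integrableOn_Ioi_rpow_of_lt (by linarith) hN')]
    · refine setLIntegral_mono' measurableSet_Ioi fun t ht => ENNReal.ofReal_le_ofReal ?_
      have ht : 0 < t := hN'.trans ht
      refine (mul_le_mul_of_nonneg_right (min_le_right _ _) (Real.rpow_nonneg ht.le _)).trans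
        (le_of_eq ?_)
      rw [Real.rpow_sub_one ht.ne', div_eq_inv_mul]
    · filter_upwards [ae_restrict_mem measurableSet_Ioi] with t ht
      exact Real.rpow_nonneg (hN'.trans ht).le _
  rw [hsplit, add_mul, ENNReal.ofReal_add (by have : 0 < 1 - β := by linarith
                                              positivity) (by positivity)]
  exact (lintegral_union_le _ _ _).trans (add_le_add hA hB)

/-! ### Upper bound: integrating the majorant in polar coordinates -/

theorem besovRho_rpow {p : ℝ} (hp : 0 < p) (f : ℂ → ℂ) :
    besovRho p f ^ p = (ENNReal.ofReal Real.pi)⁻¹ * ∫⁻ z in Metric.ball (0 : ℂ) 1,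
      ENNReal.ofReal ((1 - ‖z‖ ^ 2) ^ (p - 2)) * ‖deriv f z‖ₑ ^ p := by
  rw [besovRho, diskArea, lintegral_smul_measure, ← ENNReal.rpow_mul, one_div,
    inv_mul_cancel₀ hp.ne', ENNReal.rpow_one, smul_eq_mul]

/-- The radial factor of the majorant of `|f'| ^ p` in polar coordinates. -/
noncomputable def radialFactor (p : ℝ) (k : ℕ) (x : ℝ) : ℝ≥0∞ :=
  (Set.Ioi (0 : ℝ)).indicator
    (fun x => ENNReal.ofReal (x ^ (p - 1 - 1) * Real.exp (-(p * 2 ^ k * x)))) x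

/-- The angular factor of the majorant of `|f'| ^ p` in polar coordinates. -/
noncomputable def angularFactor (p : ℝ) (k : ℕ) (θ : ℝ) : ℝ≥0∞ :=
  ENNReal.ofReal (min ((2 : ℝ) ^ k) |θ|⁻¹ * |θ| ^ (-(1 - p⁻¹)))

theorem measurable_radialFactor (p : ℝ) (k : ℕ) : Measurable (radialFactor p k) :=
  Measurable.indicator (by fun_prop) measurableSet_Ioi

theorem measurable_angularFactor (p : ℝ) (k : ℕ) : Measurable (angularFactor p k) := by
  unfold angularFactor
  fun_prop

theorem one_sub_sq_rpow_le {p r : ℝ} (hp : 1 < p) (h0 : 0 < r) (h1 : r < 1) :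
    (1 - r ^ 2) ^ (p - 2) ≤ 2 ^ p * (1 - r) ^ (p - 1 - 1) := by
  have h2 : 1 - r ^ 2 = (1 + r) * (1 - r) := by ring
  rw [h2, Real.mul_rpow (by linarith) (by linarith), show p - 1 - 1 = p - 2 by ring]
  refine mul_le_mul_of_nonneg_right ?_ (Real.rpow_nonneg (by linarith) _)
  -- Raising the exponent to `p` first covers `p < 2` as well.
  calc (1 + r) ^ (p - 2) ≤ (1 + r) ^ p :=
        Real.rpow_le_rpow_of_exponent_le (by linarith) (by linarith)
    _ ≤ 2 ^ p := Real.rpow_le_rpow (by linarith) (by linarith) (by linarith)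

/-- From `r ≤ e^(-(1-r))`; the factor `e` pays for the `-1` in the exponent. -/
theorem pow_sub_one_le_exp {r : ℝ} (h0 : 0 < r) (k : ℕ) :
    r ^ (2 ^ k - 1) ≤ Real.exp 1 * Real.exp (-(2 ^ k * (1 - r))) := by
  have h1 : r ≤ Real.exp (-(1 - r)) := by
    have := Real.add_one_le_exp (-(1 - r)); linarith
  refine (pow_le_pow_left₀ h0.le h1 _).trans ?_
  rw [← Real.exp_nat_mul, ← Real.exp_add, Real.exp_le_exp, Nat.cast_sub Nat.one_le_two_pow]
  push_cast
  linarith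

/-- Each term of the majorant is a product of a function of `r` and a function of `θ`, so Tonelli
reduces its integral to two one-variable integrals. -/
theorem exists_polar_bound {p : ℝ} (hp : 1 < p) :
    ∃ A : ℝ, 0 < A ∧ ∀ (a : ℕ → ℝ) (f : ℂ → ℂ), (∀ n, 0 ≤ a n) → Antitone a →
      (∀ z ∈ Metric.ball (0 : ℂ) 1, f z = ∑' n : ℕ, (a n : ℂ) * z ^ n) →
      ∀ r θ : ℝ, 0 < r → r < 1 → |θ| ≤ Real.pi → θ ≠ 0 →
        ENNReal.ofReal ((1 - r ^ 2) ^ (p - 2)) *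
            ‖deriv f (r * (Real.cos θ + Real.sin θ * Complex.I))‖ₑ ^ p ≤
          ∑' k : ℕ, ENNReal.ofReal A * (dyadicTerm p a k *
            ENNReal.ofReal (((2 : ℝ) ^ k) ^ ((1 - p⁻¹) * (p - 1)))) *
              (radialFactor p k (1 - r) * angularFactor p k θ) := by
  have hp0 : 0 < p := by linarith
  have hπ := Real.pi_pos
  obtain ⟨A, hA, hAb⟩ := tsum_mul_min_rpow_le hp
  refine ⟨2 ^ p * A * (4 * Real.pi * Real.exp 1) ^ p, by positivity, ?_⟩
  intro a f h0 ha hf r θ hr0 hr1 hθ hθ0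
  set z : ℂ := r * (Real.cos θ + Real.sin θ * Complex.I) with hz
  have hnz : ‖z‖ = r := by
    rw [hz, norm_mul, Complex.norm_real, Real.norm_of_nonneg hr0.le, Complex.ofReal_cos,
      Complex.ofReal_sin, Complex.norm_cos_add_sin_mul_I, mul_one]
  have hT : 0 < |θ| := abs_pos.2 hθ0
  set c : ℕ → ℝ≥0∞ := fun k => ENNReal.ofReal
    (4 * Real.pi * Real.exp 1 * ((2 : ℝ) ^ k * a (2 ^ k)) * Real.exp (-(2 ^ k * (1 - r)))) with hc
  have hδ : ‖1 - z‖⁻¹ ≤ Real.pi * |θ|⁻¹ := by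
    have h := abs_div_pi_le_norm_one_sub r θ hr0.le hθ
    have h2 := inv_anti₀ (by positivity) h
    rwa [inv_div, div_eq_mul_inv] at h2
  have h1 : ‖deriv f z‖ₑ ≤ ∑' k : ℕ, c k * ENNReal.ofReal (min ((2 : ℝ) ^ k) |θ|⁻¹) := by
    refine (enorm_deriv_le h0 ha hf (by rwa [hnz])).trans (ENNReal.tsum_le_tsum fun k => ?_)
    have hak := h0 (2 ^ k)
    rw [hc, ← ENNReal.ofReal_mul (by positivity)]
    apply ENNReal.ofReal_le_ofReal
    have hm : min ((2 : ℝ) ^ k) ‖1 - z‖⁻¹ ≤ Real.pi * min ((2 : ℝ) ^ k) |θ|⁻¹ := by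
      rw [mul_min_of_nonneg _ _ hπ.le]
      refine min_le_min ?_ hδ
      have : (0 : ℝ) < 2 ^ k := by positivity
      nlinarith [Real.two_le_pi]
    rw [hnz]
    have hm0 : 0 ≤ min ((2 : ℝ) ^ k) ‖1 - z‖⁻¹ := by positivity
    calc _ ≤ 4 * ((2 : ℝ) ^ k * a (2 ^ k) * (Real.exp 1 * Real.exp (-(2 ^ k * (1 - r))))) *
          (Real.pi * min ((2 : ℝ) ^ k) |θ|⁻¹) := by
            gcongr
            exact pow_sub_one_le_exp hr0 k
      _ = _ := by ring
  have h2 := (ENNReal.rpow_le_rpow h1 hp0.le).trans (hAb c |θ| hT)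
  have h3 := mul_le_mul' (ENNReal.ofReal_le_ofReal (one_sub_sq_rpow_le hp hr0 hr1)) h2
  refine h3.trans (le_of_eq ?_)
  rw [← mul_assoc, ← ENNReal.tsum_mul_left]
  refine tsum_congr fun k => ?_
  have hak := h0 (2 ^ k)
  have hx : 0 < 1 - r := by linarith
  rw [hc]
  simp only
  rw [ENNReal.ofReal_rpow_of_nonneg (by positivity) hp0.le, Real.mul_rpow (by positivity)
    (by positivity), Real.mul_rpow (by positivity) (by positivity), ← Real.exp_mul,
    radialFactor, Set.indicator_of_mem (Set.mem_Ioi.2 hx), angularFactor, dyadicTerm,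
    ENNReal.ofReal_mul (by positivity), ENNReal.ofReal_mul (by positivity),
    ENNReal.ofReal_mul (by positivity), ENNReal.ofReal_mul (by positivity),
    ENNReal.ofReal_mul (by positivity), ENNReal.ofReal_mul (by positivity),
    ENNReal.ofReal_mul (Real.rpow_nonneg hx.le (p - 1 - 1)),
    show -(2 ^ k * (1 - r)) * p = -(p * 2 ^ k * (1 - r)) by ring]
  ring

theorem lintegral_radialFactor {p : ℝ} (hp : 1 < p) (k : ℕ) :
    ∫⁻ r : ℝ, radialFactor p k (1 - r) =
      ENNReal.ofReal ((1 / (p * 2 ^ k)) ^ (p - 1) * Real.Gamma (p - 1)) := by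
  rw [lintegral_sub_left_eq_self (radialFactor p k) 1]
  unfold radialFactor
  rw [lintegral_indicator measurableSet_Ioi,
    lintegral_rpow_mul_exp_neg (by linarith) (by have : 0 < p := by linarith
                                                 positivity)]

/-- Scale invariance: the exponents of `2^k` are `β(p-1)`, `-(p-1)` and `β`, and they sum to zero.
-/
theorem exists_lintegral_factors_le {p : ℝ} (hp : 1 < p) :
    ∃ D : ℝ, 0 < D ∧ ∀ k : ℕ,
      ENNReal.ofReal (((2 : ℝ) ^ k) ^ ((1 - p⁻¹) * (p - 1))) *
        ∫⁻ q : ℝ × ℝ, radialFactor p k (1 - q.1) * angularFactor p k q.2 ≤ ENNReal.ofReal D := by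
  have hp0 : 0 < p := by linarith
  have hβ0 : 0 < 1 - p⁻¹ := sub_pos.2 (inv_lt_one_of_one_lt₀ hp)
  have hβ1 : 1 - p⁻¹ < 1 := by have := inv_pos.2 hp0; linarith
  set β := 1 - p⁻¹ with hβ
  have hβp : β * (p - 1) + β - (p - 1) = 0 := by rw [hβ]; field_simp; ring
  have hΓ : 0 < Real.Gamma (p - 1) := Real.Gamma_pos_of_pos (by linarith)
  have hD : 0 < 2 * (1 / (1 - β) + 1 / β) := by
    have : 0 < 1 - β := by linarith
    positivity
  refine ⟨(1 / p) ^ (p - 1) * Real.Gamma (p - 1) * (2 * (1 / (1 - β) + 1 / β)), by positivity,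
    fun k => ?_⟩
  have hN : (0 : ℝ) < 2 ^ k := by positivity
  rw [Measure.volume_eq_prod, lintegral_prod_mul (f := fun r => radialFactor p k (1 - r))
    ((measurable_radialFactor p k).comp (measurable_const.sub measurable_id)).aemeasurable
    (measurable_angularFactor p k).aemeasurable, lintegral_radialFactor hp]
  have hang : ∫⁻ θ, angularFactor p k θ ≤ _ := lintegral_min_mul_rpow_le hβ0 hβ1 hN
  refine (mul_le_mul_right (mul_le_mul_right hang _) _).trans (le_of_eq ?_)
  rw [← ENNReal.ofReal_mul (by positivity), ← ENNReal.ofReal_mul (by positivity)]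
  congr 1
  have e : ((2 : ℝ) ^ k) ^ (β * (p - 1)) * (1 / 2 ^ k) ^ (p - 1) * ((2 : ℝ) ^ k) ^ β = 1 := by
    rw [one_div, Real.inv_rpow hN.le, ← Real.rpow_neg hN.le, ← Real.rpow_add hN,
      ← Real.rpow_add hN, show β * (p - 1) + -(p - 1) + β = β * (p - 1) + β - (p - 1) by ring, hβp,
      Real.rpow_zero]
  have e2 : (1 / (p * 2 ^ k)) ^ (p - 1) = (1 / p) ^ (p - 1) * (1 / (2 : ℝ) ^ k) ^ (p - 1) := by
    rw [← Real.mul_rpow (by positivity) (by positivity)]; congr 1; field_simp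
  rw [e2]
  calc _ = (1 / p) ^ (p - 1) * Real.Gamma (p - 1) * (2 * (1 / (1 - β) + 1 / β)) *
        (((2 : ℝ) ^ k) ^ (β * (p - 1)) * (1 / 2 ^ k) ^ (p - 1) * ((2 : ℝ) ^ k) ^ β) := by ring
    _ = _ := by rw [e, mul_one]

theorem exists_besovRho_le {p : ℝ} (hp : 1 < p) :
    ∃ C : ℝ, 0 < C ∧ ∀ (a : ℕ → ℝ) (f : ℂ → ℂ), (∀ n, 0 ≤ a n) → Antitone a →
      (∀ z ∈ Metric.ball (0 : ℂ) 1, f z = ∑' n : ℕ, (a n : ℂ) * z ^ n) →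
      besovRho p f ^ p ≤ ENNReal.ofReal C * ∑' k, dyadicTerm p a k := by
  have hp0 : 0 < p := by linarith
  obtain ⟨A, hA, hpt⟩ := exists_polar_bound hp
  obtain ⟨D, hD, hint⟩ := exists_lintegral_factors_le hp
  have hπ := Real.pi_pos
  refine ⟨Real.pi⁻¹ * (A * D), by positivity, fun a f h0 ha hf => ?_⟩
  rw [besovRho_rpow hp0, ENNReal.ofReal_mul (by positivity), ENNReal.ofReal_inv_of_pos hπ, mul_assoc]
  refine mul_le_mul_right ?_ _
  rw [← lintegral_indicator Metric.isOpen_ball.measurableSet,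
    ← Complex.lintegral_comp_polarCoord_symm]
  set G : ℝ × ℝ → ℝ≥0∞ := fun q => ∑' k : ℕ, ENNReal.ofReal A * (dyadicTerm p a k *
            ENNReal.ofReal (((2 : ℝ) ^ k) ^ ((1 - p⁻¹) * (p - 1)))) *
              (radialFactor p k (1 - q.1) * angularFactor p k q.2) with hG
  -- On the null set `θ = 0` the convention `0⁻¹ = 0` would spoil the majorant.
  have hne : ∀ᵐ q : ℝ × ℝ, q.2 ≠ 0 := by
    have h : ∀ᵐ t : ℝ, t ≠ 0 := Measure.ae_ne volume 0
    exact Measure.quasiMeasurePreserving_snd.ae h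
  have hmeas : MeasurableSet polarCoord.target := polarCoord.open_target.measurableSet
  calc _ ≤ ∫⁻ q in polarCoord.target, G q := by
        refine lintegral_mono_ae ?_
        filter_upwards [ae_restrict_mem hmeas, ae_restrict_of_ae hne] with q hq hq2
        obtain ⟨hr, hθ⟩ := hq
        have hr : 0 < q.1 := hr
        have hθ' : |q.2| ≤ Real.pi := abs_le.2 ⟨hθ.1.le, hθ.2.le⟩
        have hn : ‖Complex.polarCoord.symm q‖ = q.1 := by
          rw [Complex.norm_polarCoord_symm, abs_of_pos hr]
        by_cases hr1 : q.1 < 1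
        · rw [Set.indicator_of_mem (by rwa [mem_ball_zero_iff, hn]), hn, smul_eq_mul,
            Complex.polarCoord_symm_apply]
          have h := hpt a f h0 ha hf q.1 q.2 hr hr1 hθ' hq2
          -- The polar Jacobian `r` is at most `1` and is dropped.
          exact (mul_le_mul' (ENNReal.ofReal_le_one.2 hr1.le) h).trans_eq (one_mul _)
        · rw [Set.indicator_of_notMem (by rwa [mem_ball_zero_iff, hn]), smul_zero]
          exact zero_le
    _ ≤ ∫⁻ q, G q := setLIntegral_le_lintegral _ _
    _ = ∑' k : ℕ, ENNReal.ofReal A * (dyadicTerm p a k *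
            ENNReal.ofReal (((2 : ℝ) ^ k) ^ ((1 - p⁻¹) * (p - 1)))) *
              ∫⁻ q : ℝ × ℝ, radialFactor p k (1 - q.1) * angularFactor p k q.2 := by
        have hm : ∀ k, Measurable fun q : ℝ × ℝ =>
            radialFactor p k (1 - q.1) * angularFactor p k q.2 := fun k =>
          ((measurable_radialFactor p k).comp (measurable_const.sub measurable_fst)).mul
            ((measurable_angularFactor p k).comp measurable_snd)
        rw [lintegral_tsum fun k => ((hm k).const_mul _).aemeasurable]
        exact tsum_congr fun k => lintegral_const_mul _ (hm k)
    _ ≤ ∑' k : ℕ, ENNReal.ofReal (A * D) * dyadicTerm p a k := by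
        refine ENNReal.tsum_le_tsum fun k => ?_
        rw [mul_assoc, mul_assoc]
        refine (mul_le_mul_right (mul_le_mul_right (hint k) _) _).trans (le_of_eq ?_)
        rw [ENNReal.ofReal_mul hA.le]; ring
    _ = _ := ENNReal.tsum_mul_left

/-! ### Sub-mean value property of `|g|^p` for holomorphic `g` -/

theorem lintegral_rpow_le_measure_univ_mul {α : Type*} [MeasurableSpace α] (μ : Measure α) {p : ℝ}
    (hp : 1 < p) {h : α → ℝ≥0∞} (hh : AEMeasurable h μ) :
    (∫⁻ x, h x ∂μ) ^ p ≤ μ Set.univ ^ (p - 1) * ∫⁻ x, h x ^ p ∂μ := by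
  have hp0 : 0 < p := by linarith
  have hq := Real.HolderConjugate.conjExponent hp
  have h1 := ENNReal.lintegral_mul_le_Lp_mul_Lq μ hq hh (aemeasurable_const (b := (1 : ℝ≥0∞)))
  simp only [Pi.mul_apply, mul_one, ENNReal.one_rpow, lintegral_const, one_mul] at h1
  refine (ENNReal.rpow_le_rpow h1 hp0.le).trans (le_of_eq ?_)
  rw [ENNReal.mul_rpow_of_nonneg _ _ hp0.le, ← ENNReal.rpow_mul, ← ENNReal.rpow_mul, one_div,
    inv_mul_cancel₀ hp0.ne', ENNReal.rpow_one, mul_comm]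
  congr 2
  rw [Real.conjExponent]
  have : p - 1 ≠ 0 := by linarith
  field_simp

theorem enorm_rpow_le_lintegral_circle {p : ℝ} (hp : 1 < p) {g : ℂ → ℂ} {c : ℂ} {r : ℝ} (hr : 0 < r)
    (hg : DifferentiableOn ℂ g (Metric.closedBall c r)) :
    ENNReal.ofReal (2 * Real.pi) * ‖g c‖ₑ ^ p ≤
      ∫⁻ θ in Set.Ioo (-Real.pi) Real.pi, ‖g (circleMap c r θ)‖ₑ ^ p := by
  have hπ := Real.pi_pos
  have hp0 : 0 < p := by linarith
  have hcont : Continuous fun θ => g (circleMap c r θ) :=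
    hg.continuousOn.comp_continuous (continuous_circleMap c r)
      fun θ => circleMap_mem_closedBall c hr.le θ
  have hmv : Real.circleAverage g c r = g c := by
    apply DiffContOnCl.circleAverage
    rw [abs_of_pos hr]
    exact hg.diffContOnCl_ball subset_rfl
  rw [Real.circleAverage_def] at hmv
  -- Periodicity moves the circle average to `(-π, π)`, the angular range of `polarCoord`.
  have hshift : ∫ θ in (0 : ℝ)..2 * Real.pi, g (circleMap c r θ) =
      ∫ θ in (-Real.pi)..Real.pi, g (circleMap c r θ) := by
    have hper : Function.Periodic (fun θ => g (circleMap c r θ)) (2 * Real.pi) := fun θ => by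
      simp only [periodic_circleMap c r θ]
    have := hper.intervalIntegral_add_eq 0 (-Real.pi)
    rwa [zero_add, show -Real.pi + 2 * Real.pi = Real.pi by ring] at this
  have hval : ∫ θ in Set.Ioo (-Real.pi) Real.pi, g (circleMap c r θ) = (2 * Real.pi : ℝ) • g c := by
    rw [← integral_Ioc_eq_integral_Ioo, ← intervalIntegral.integral_of_le (by linarith), ← hshift,
      ← hmv, smul_smul, mul_inv_cancel₀ (by positivity), one_smul]
  have h1 := enorm_integral_le_lintegral_enorm (μ := volume.restrict (Set.Ioo (-Real.pi) Real.pi))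
    fun θ => g (circleMap c r θ)
  have h2 : ‖((2 * Real.pi : ℝ) • g c)‖ₑ = ENNReal.ofReal (2 * Real.pi) * ‖g c‖ₑ := by
    rw [enorm_smul, Real.enorm_of_nonneg (by positivity)]
  rw [hval, h2] at h1
  have h3 := (ENNReal.rpow_le_rpow h1 hp0.le).trans
    (lintegral_rpow_le_measure_univ_mul _ hp hcont.enorm.measurable.aemeasurable)
  rw [Measure.restrict_apply_univ, Real.volume_Ioo, sub_neg_eq_add, ← two_mul,
    ENNReal.mul_rpow_of_nonneg _ _ hp0.le] at h3
  have hT0 : ENNReal.ofReal (2 * Real.pi) ≠ 0 := by simpa using hπ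
  have e : ENNReal.ofReal (2 * Real.pi) ^ p =
      ENNReal.ofReal (2 * Real.pi) ^ (p - 1) * ENNReal.ofReal (2 * Real.pi) := by
    conv_rhs => rw [← ENNReal.rpow_one (ENNReal.ofReal (2 * Real.pi)), ← ENNReal.rpow_mul, one_mul,
      ← ENNReal.rpow_add _ _ hT0 ENNReal.ofReal_ne_top, sub_add_cancel]
  rw [e, mul_assoc] at h3
  refine (ENNReal.mul_le_mul_iff_right ?_ ?_).1 h3
  · exact (ENNReal.rpow_pos (pos_iff_ne_zero.2 hT0) ENNReal.ofReal_ne_top).ne'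
  · exact ENNReal.rpow_ne_top_of_nonneg (by linarith) ENNReal.ofReal_ne_top

/-- Integrate the circle inequality against `r dr` over `0 < r < R`; every such circle bounds a
closed disc inside the open ball. -/
theorem enorm_rpow_le_lintegral_ball {p : ℝ} (hp : 1 < p) {g : ℂ → ℂ} {c : ℂ} {R : ℝ}
    (hR : 0 < R) (hg : DifferentiableOn ℂ g (Metric.ball c R)) :
    ENNReal.ofReal (Real.pi * R ^ 2) * ‖g c‖ₑ ^ p ≤ ∫⁻ z in Metric.ball c R, ‖g z‖ₑ ^ p := by
  have hπ := Real.pi_pos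
  have hp0 : 0 < p := by linarith
  set S : Set (ℝ × ℝ) := Set.Ioo 0 R ×ˢ Set.Ioo (-Real.pi) Real.pi with hS
  have hSo : IsOpen S := isOpen_Ioo.prod isOpen_Ioo
  have hsub : S ⊆ polarCoord.target := fun q hq => ⟨hq.1.1, hq.2⟩
  have hsymm : ∀ q : ℝ × ℝ, c + Complex.polarCoord.symm q = circleMap c q.1 q.2 := fun q => by
    rw [Complex.polarCoord_symm_apply, circleMap, Complex.exp_mul_I, Complex.ofReal_cos,
      Complex.ofReal_sin]
  have hmem : ∀ q ∈ S, circleMap c q.1 q.2 ∈ Metric.ball c R := fun q hq => by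
    rw [mem_ball_iff_norm, circleMap, add_sub_cancel_left, norm_mul, Complex.norm_exp_ofReal_mul_I,
      mul_one, Complex.norm_real, Real.norm_of_nonneg hq.1.1.le]
    exact hq.1.2
  have hcont : ContinuousOn (fun q : ℝ × ℝ => g (circleMap c q.1 q.2)) S := by
    refine hg.continuousOn.comp ?_ hmem
    unfold circleMap
    fun_prop
  have hmeas : AEMeasurable
      (fun q : ℝ × ℝ => ENNReal.ofReal q.1 * ‖g (circleMap c q.1 q.2)‖ₑ ^ p)
      ((volume.restrict (Set.Ioo 0 R)).prod (volume.restrict (Set.Ioo (-Real.pi) Real.pi))) := by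
    rw [Measure.prod_restrict, ← Measure.volume_eq_prod]
    refine AEMeasurable.mul (by fun_prop) ?_
    exact ((hcont.aemeasurable hSo.measurableSet).enorm).pow_const p
  have hrad : ∫⁻ r in Set.Ioo 0 R, ENNReal.ofReal r = ENNReal.ofReal (R ^ 2 / 2) := by
    have h1 : ∫ r in Set.Ioo 0 R, r = R ^ 2 / 2 := by
      rw [← integral_Ioc_eq_integral_Ioo, ← intervalIntegral.integral_of_le hR.le, integral_id]
      ring
    rw [← h1, ofReal_integral_eq_lintegral_ofReal]
    · exact (continuous_id.integrableOn_Icc (a := 0) (b := R)).mono_set Set.Ioo_subset_Icc_self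
    · filter_upwards [ae_restrict_mem measurableSet_Ioo] with r hr using hr.1.le
  calc ENNReal.ofReal (Real.pi * R ^ 2) * ‖g c‖ₑ ^ p
      = ∫⁻ r in Set.Ioo 0 R, ENNReal.ofReal r * (ENNReal.ofReal (2 * Real.pi) * ‖g c‖ₑ ^ p) := by
        rw [lintegral_mul_const _ ENNReal.measurable_ofReal, hrad, ← mul_assoc,
          ← ENNReal.ofReal_mul (by positivity)]
        congr 2; ring
    _ ≤ ∫⁻ r in Set.Ioo 0 R, ENNReal.ofReal r *
          ∫⁻ θ in Set.Ioo (-Real.pi) Real.pi, ‖g (circleMap c r θ)‖ₑ ^ p := by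
        refine setLIntegral_mono' measurableSet_Ioo fun r hr => ?_
        gcongr
        exact enorm_rpow_le_lintegral_circle hp hr.1
          (hg.mono (Metric.closedBall_subset_ball hr.2))
    _ = ∫⁻ r in Set.Ioo 0 R, ∫⁻ θ in Set.Ioo (-Real.pi) Real.pi,
          ENNReal.ofReal r * ‖g (circleMap c r θ)‖ₑ ^ p := by
        congr 1 with r
        rw [lintegral_const_mul' _ _ ENNReal.ofReal_ne_top]
    _ = ∫⁻ q in S, ENNReal.ofReal q.1 * ‖g (circleMap c q.1 q.2)‖ₑ ^ p := by
        rw [← lintegral_prod _ hmeas, Measure.prod_restrict, ← Measure.volume_eq_prod]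
    _ = ∫⁻ q in S, ENNReal.ofReal q.1 • (Metric.ball c R).indicator (fun z => ‖g z‖ₑ ^ p)
          (c + Complex.polarCoord.symm q) := by
        refine setLIntegral_congr_fun hSo.measurableSet fun q hq => ?_
        simp only [hsymm, Set.indicator_of_mem (hmem q hq), smul_eq_mul]
    _ ≤ ∫⁻ q in polarCoord.target, ENNReal.ofReal q.1 •
          (Metric.ball c R).indicator (fun z => ‖g z‖ₑ ^ p) (c + Complex.polarCoord.symm q) :=
        lintegral_mono_set hsub
    _ = ∫⁻ z in Metric.ball c R, ‖g z‖ₑ ^ p := by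
        rw [Complex.lintegral_comp_polarCoord_symm fun w =>
          (Metric.ball c R).indicator (fun z => ‖g z‖ₑ ^ p) (c + w),
          lintegral_add_left_eq_self (fun w => (Metric.ball c R).indicator (fun z => ‖g z‖ₑ ^ p) w),
          lintegral_indicator Metric.isOpen_ball.measurableSet]

/-! ### Lower bound: discs approaching the point `1` -/

/-- The `k`-th of a sequence of disjoint discs in `𝔻` approaching the point `1`. -/
def dyadicDisc (k : ℕ) : Set ℂ :=
  Metric.ball (((1 - 3 / 4 / 2 ^ k : ℝ)) : ℂ) (1 / 4 / 2 ^ k)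

theorem measurableSet_dyadicDisc (k : ℕ) : MeasurableSet (dyadicDisc k) :=
  Metric.isOpen_ball.measurableSet

/-- Consecutive annuli share only a boundary radius, so these bounds give disjointness; they also
fix the size of the weight on each disc. -/
theorem norm_bounds_of_mem_dyadicDisc {k : ℕ} {z : ℂ} (hz : z ∈ dyadicDisc k) :
    1 - 1 / 2 ^ k < ‖z‖ ∧ ‖z‖ < 1 - 1 / 2 / 2 ^ k := by
  have hN : (1 : ℝ) ≤ 2 ^ k := one_le_pow₀ (by norm_num)
  rw [dyadicDisc, mem_ball_iff_norm] at hz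
  have h3 : (3 : ℝ) / 4 / 2 ^ k ≤ 1 := by rw [div_le_one (by positivity)]; linarith
  have hc : ‖(((1 - 3 / 4 / 2 ^ k : ℝ)) : ℂ)‖ = 1 - 3 / 4 / 2 ^ k := by
    rw [Complex.norm_real, Real.norm_of_nonneg (by linarith)]
  have h1 := abs_le.1 (abs_norm_sub_norm_le z (((1 - 3 / 4 / 2 ^ k : ℝ)) : ℂ))
  rw [hc] at h1
  have e1 : (1 : ℝ) / 2 ^ k = 3 / 4 / 2 ^ k + 1 / 4 / 2 ^ k := by ring
  have e2 : (1 : ℝ) / 2 / 2 ^ k = 3 / 4 / 2 ^ k - 1 / 4 / 2 ^ k := by ring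
  constructor <;> linarith [h1.1, h1.2]

theorem dyadicDisc_subset (k : ℕ) : dyadicDisc k ⊆ Metric.ball 0 1 := fun z hz => by
  have h := (norm_bounds_of_mem_dyadicDisc hz).2
  have : (0 : ℝ) < 1 / 2 / 2 ^ k := by positivity
  rw [mem_ball_zero_iff]
  linarith

theorem pairwise_disjoint_dyadicDisc : Pairwise (Function.onFun Disjoint dyadicDisc) := by
  have key : ∀ k l : ℕ, k < l → Disjoint (dyadicDisc k) (dyadicDisc l) := by
    intro k l hkl
    rw [Set.disjoint_left]
    intro z hk hl
    have h1 := (norm_bounds_of_mem_dyadicDisc hk).2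
    have h2 := (norm_bounds_of_mem_dyadicDisc hl).1
    have h3 : (1 : ℝ) / 2 ^ l ≤ 1 / 2 / 2 ^ k := by
      rw [div_div, ← pow_succ']
      exact one_div_le_one_div_of_le (by positivity) (pow_le_pow_right₀ (by norm_num) hkl)
    linarith
  intro k l hkl
  rcases hkl.lt_or_gt with h | h
  · exact key k l h
  · exact (key l k h).symm

/-- At a positive radius only `n ≤ 2^k` need be kept. There `a n ≥ a (2^k)`, and Bernoulli gives
`r^(2^k) ≥ 1 - 3/4 = 1/4`. As `∑ n ≥ 4^k / 2`, the constant is `1/8`. -/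
theorem le_norm_deriv {a : ℕ → ℝ} {f : ℂ → ℂ} (h0 : ∀ n, 0 ≤ a n) (ha : Antitone a)
    (hf : ∀ z ∈ Metric.ball (0 : ℂ) 1, f z = ∑' n : ℕ, (a n : ℂ) * z ^ n) (k : ℕ) :
    a (2 ^ k) * (2 ^ k) ^ 2 / 8 ≤ ‖deriv f ((1 - 3 / 4 / 2 ^ k : ℝ) : ℂ)‖ := by
  have hN : (1 : ℝ) ≤ 2 ^ k := one_le_pow₀ (by norm_num)
  have h3 : (3 : ℝ) / 4 / 2 ^ k ≤ 3 / 4 := div_le_self (by norm_num) hN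
  have h3' : (0 : ℝ) < 3 / 4 / 2 ^ k := by positivity
  set r : ℝ := 1 - 3 / 4 / 2 ^ k with hr
  have hr0 : 0 ≤ r := by linarith
  have hr1 : r < 1 := by linarith
  have hs := Complex.hasSum_re (hasSum_deriv h0 ha hf (z := (r : ℂ))
    (by rwa [Complex.norm_real, Real.norm_of_nonneg hr0]))
  have hs : HasSum (fun n : ℕ => (n : ℝ) * a n * r ^ (n - 1)) (deriv f r).re := by
    refine hs.congr_fun fun n => ?_
    have : (n : ℂ) * a n * (r : ℂ) ^ (n - 1) = (((n : ℝ) * a n * r ^ (n - 1) : ℝ) : ℂ) := by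
      push_cast; rfl
    rw [this, Complex.ofReal_re]
  have hsum := sum_le_hasSum (Finset.range (2 ^ k + 1))
    (fun n _ => by have := h0 n; positivity) hs
  have hrN : 1 / 4 ≤ r ^ (2 ^ k) := by
    have h := one_add_mul_le_pow (a := -(3 / 4 / 2 ^ k : ℝ)) (by linarith) (2 ^ k)
    have e : 1 + ((2 ^ k : ℕ) : ℝ) * -(3 / 4 / 2 ^ k) = 1 / 4 := by
      push_cast; field_simp; norm_num
    rwa [e, ← sub_eq_add_neg] at h
  have hb : ∀ n ∈ Finset.range (2 ^ k + 1),
      (n : ℝ) * (a (2 ^ k) * (1 / 4)) ≤ (n : ℝ) * a n * r ^ (n - 1) := by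
    intro n hn
    have hn : n ≤ 2 ^ k := Nat.lt_succ_iff.1 (Finset.mem_range.1 hn)
    rw [mul_assoc]
    have h5 : 1 / 4 ≤ r ^ (n - 1) := hrN.trans (pow_le_pow_of_le_one hr0 hr1.le (by omega))
    have := h0 n
    have := ha hn
    gcongr
  refine le_trans ?_ ((Finset.sum_le_sum hb).trans (hsum.trans (Complex.re_le_norm _)))
  rw [← Finset.sum_mul]
  have hg : (∑ n ∈ Finset.range (2 ^ k + 1), (n : ℝ)) * 2 = (2 ^ k + 1) * 2 ^ k := by
    have := congrArg (Nat.cast : ℕ → ℝ) (Finset.sum_range_id_mul_two (2 ^ k + 1))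
    rw [Nat.add_sub_cancel] at this
    push_cast at this
    exact this
  have hak := h0 (2 ^ k)
  have : (∑ n ∈ Finset.range (2 ^ k + 1), (n : ℝ)) = (2 ^ k + 1) * 2 ^ k / 2 := by linarith
  rw [this]
  have h6 : 0 ≤ a (2 ^ k) * 2 ^ k := by positivity
  nlinarith

/-- `(1 - |z|²) 2^k` lies in `[1/2, 2]`, so its power `p - 2`, of either sign, is at least
`2^(-|p-2|) ≥ 2^(-p)`. -/
theorem le_one_sub_sq_rpow {p : ℝ} (hp : 1 < p) {k : ℕ} {z : ℂ} (hz : z ∈ dyadicDisc k) :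
    (1 / 2) ^ p * (1 / 2 ^ k) ^ (p - 2) ≤ (1 - ‖z‖ ^ 2) ^ (p - 2) := by
  have hN : (0 : ℝ) < 2 ^ k := by positivity
  obtain ⟨h1, h2⟩ := norm_bounds_of_mem_dyadicDisc hz
  have h3 := norm_nonneg z
  have h0 : (0 : ℝ) < 1 / 2 / 2 ^ k := by positivity
  have e : 1 - ‖z‖ ^ 2 = ((1 - ‖z‖ ^ 2) * 2 ^ k) * (1 / 2 ^ k) := by field_simp
  have hl : 1 / 2 ≤ (1 - ‖z‖ ^ 2) * 2 ^ k := by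
    rw [← div_le_iff₀ hN]; nlinarith
  have hu : (1 - ‖z‖ ^ 2) * 2 ^ k ≤ 2 := by
    rw [← le_div_iff₀ hN]
    have : (2 : ℝ) / 2 ^ k = 2 * (1 / 2 ^ k) := by ring
    rw [this]; nlinarith
  rw [e, Real.mul_rpow (by linarith) (by positivity)]
  refine mul_le_mul_of_nonneg_right ?_ (by positivity)
  rcases le_total 2 p with h | h
  · calc (1 / 2 : ℝ) ^ p ≤ (1 / 2) ^ (p - 2) :=
          Real.rpow_le_rpow_of_exponent_ge (by norm_num) (by norm_num) (by linarith)
      _ ≤ _ := Real.rpow_le_rpow (by norm_num) hl (by linarith)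
  · calc (1 / 2 : ℝ) ^ p ≤ (1 / 2) ^ (2 - p) :=
          Real.rpow_le_rpow_of_exponent_ge (by norm_num) (by norm_num) (by linarith)
      _ = 2 ^ (p - 2) := by
          rw [one_div, Real.inv_rpow (by norm_num), ← Real.rpow_neg (by norm_num)]
          congr 1; ring
      _ ≤ _ := Real.rpow_le_rpow_of_nonpos (by linarith) hu (by linarith)

theorem dyadicTerm_le_lintegral_dyadicDisc {p : ℝ} (hp : 1 < p) {a : ℕ → ℝ} {f : ℂ → ℂ}
    (h0 : ∀ n, 0 ≤ a n) (ha : Antitone a)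
    (hf : ∀ z ∈ Metric.ball (0 : ℂ) 1, f z = ∑' n : ℕ, (a n : ℂ) * z ^ n) (k : ℕ) :
    ENNReal.ofReal ((1 / 2) ^ p * (Real.pi / 16) * (1 / 8) ^ p) * dyadicTerm p a k ≤
      ∫⁻ z in dyadicDisc k, ENNReal.ofReal ((1 - ‖z‖ ^ 2) ^ (p - 2)) * ‖deriv f z‖ₑ ^ p := by
  have hp0 : 0 < p := by linarith
  have hπ := Real.pi_pos
  have hN : (0 : ℝ) < 2 ^ k := by positivity
  have hak := h0 (2 ^ k)
  have hd : DifferentiableOn ℂ (deriv f) (dyadicDisc k) :=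
    ((differentiableOn_of_eq_tsum h0 ha hf).deriv Metric.isOpen_ball).mono (dyadicDisc_subset k)
  have hmv := enorm_rpow_le_lintegral_ball hp (by positivity) hd
  have hlow : ENNReal.ofReal ((a (2 ^ k) * (2 ^ k) ^ 2 / 8) ^ p) ≤
      ‖deriv f ((1 - 3 / 4 / 2 ^ k : ℝ) : ℂ)‖ₑ ^ p := by
    rw [← ENNReal.ofReal_rpow_of_nonneg (by positivity) hp0.le, ← ofReal_norm]
    exact ENNReal.rpow_le_rpow (ENNReal.ofReal_le_ofReal (le_norm_deriv h0 ha hf k)) hp0.le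
  -- Weight `2^(-k(p-2))` times area `2^(-2k)` is `2^(-kp)`, which turns `(4^k a_{2^k})^p` into
  -- `(2^k a_{2^k})^p`.
  calc _ = ENNReal.ofReal ((1 / 2) ^ p * (1 / 2 ^ k) ^ (p - 2)) *
        (ENNReal.ofReal (Real.pi * (1 / 4 / 2 ^ k) ^ 2) *
          ENNReal.ofReal ((a (2 ^ k) * (2 ^ k) ^ 2 / 8) ^ p)) := by
        rw [dyadicTerm, ← ENNReal.ofReal_mul (by positivity), ← ENNReal.ofReal_mul (by positivity),
          ← ENNReal.ofReal_mul (by positivity)]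
        congr 1
        have e1 : (1 / (2 : ℝ) ^ k) ^ (p - 2) * (1 / 2 ^ k) ^ 2 = (1 / 2 ^ k) ^ p := by
          rw [← Real.rpow_natCast (1 / 2 ^ k) 2, ← Real.rpow_add (by positivity)]
          congr 1; push_cast; ring
        have e2 : (1 / (2 : ℝ) ^ k) ^ p * (a (2 ^ k) * (2 ^ k) ^ 2 / 8) ^ p =
            (1 / 8) ^ p * (2 ^ k * a (2 ^ k)) ^ p := by
          rw [← Real.mul_rpow (by positivity) (by positivity),
            ← Real.mul_rpow (by positivity) (by positivity)]
          congr 1; field_simp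
        calc _ = (1 / 2) ^ p * (Real.pi / 16) * ((1 / 8) ^ p * (2 ^ k * a (2 ^ k)) ^ p) := by ring
          _ = (1 / 2) ^ p * (Real.pi / 16) *
              (((1 / (2 : ℝ) ^ k) ^ (p - 2) * (1 / 2 ^ k) ^ 2) *
                (a (2 ^ k) * (2 ^ k) ^ 2 / 8) ^ p) := by rw [e1, e2]
          _ = _ := by ring
    _ ≤ ENNReal.ofReal ((1 / 2) ^ p * (1 / 2 ^ k) ^ (p - 2)) *
          ∫⁻ z in dyadicDisc k, ‖deriv f z‖ₑ ^ p :=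
        mul_le_mul_right ((mul_le_mul_right hlow _).trans hmv) _
    _ = ∫⁻ z in dyadicDisc k,
          ENNReal.ofReal ((1 / 2) ^ p * (1 / 2 ^ k) ^ (p - 2)) * ‖deriv f z‖ₑ ^ p :=
        (lintegral_const_mul' _ _ ENNReal.ofReal_ne_top).symm
    _ ≤ _ := by
        refine setLIntegral_mono' Metric.isOpen_ball.measurableSet fun z hz => ?_
        gcongr
        exact le_one_sub_sq_rpow hp hz

theorem exists_le_besovRho {p : ℝ} (hp : 1 < p) :
    ∃ c : ℝ, 0 < c ∧ ∀ (a : ℕ → ℝ) (f : ℂ → ℂ), (∀ n, 0 ≤ a n) → Antitone a →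
      (∀ z ∈ Metric.ball (0 : ℂ) 1, f z = ∑' n : ℕ, (a n : ℂ) * z ^ n) →
      ENNReal.ofReal c * ∑' k, dyadicTerm p a k ≤ besovRho p f ^ p := by
  have hp0 : 0 < p := by linarith
  have hπ := Real.pi_pos
  refine ⟨Real.pi⁻¹ * ((1 / 2) ^ p * (Real.pi / 16) * (1 / 8) ^ p), by positivity,
    fun a f h0 ha hf => ?_⟩
  rw [besovRho_rpow hp0, ENNReal.ofReal_mul (by positivity), ENNReal.ofReal_inv_of_pos hπ, mul_assoc,
    ← ENNReal.tsum_mul_left]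
  refine mul_le_mul_right ?_ _
  refine (ENNReal.tsum_le_tsum (dyadicTerm_le_lintegral_dyadicDisc hp h0 ha hf)).trans ?_
  rw [← lintegral_iUnion measurableSet_dyadicDisc pairwise_disjoint_dyadicDisc]
  exact lintegral_mono_set (Set.iUnion_subset dyadicDisc_subset)

/-! ### Two-sided estimate and membership criterion -/

theorem exists_besovRho_bounds {p : ℝ} (hp : 1 < p) :
    ∃ c C : ℝ, 0 < c ∧ 0 < C ∧
      ∀ (a : ℕ → ℝ) (f : ℂ → ℂ), (∀ n, 0 ≤ a n) → Antitone a →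
        (∀ z ∈ Metric.ball (0 : ℂ) 1, f z = ∑' n : ℕ, (a n : ℂ) * z ^ n) →
          ENNReal.ofReal c *
              ∑' n : ℕ, ENNReal.ofReal (((n + 1 : ℕ) : ℝ) ^ (p - 1) * a (n + 1) ^ p)
            ≤ besovRho p f ^ p ∧
          besovRho p f ^ p ≤
            ENNReal.ofReal C *
              ∑' n : ℕ, ENNReal.ofReal (((n + 1 : ℕ) : ℝ) ^ (p - 1) * a (n + 1) ^ p) := by
  obtain ⟨c, hc, hlow⟩ := exists_le_besovRho hp
  obtain ⟨C, hC, hup⟩ := exists_besovRho_le hp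
  refine ⟨c / 2 ^ p, C * (1 + 2 ^ p), by positivity, by positivity, fun a f h0 ha hf => ⟨?_, ?_⟩⟩
  · refine le_trans ?_ (hlow a f h0 ha hf)
    refine (mul_le_mul_right (tsum_le_tsum_dyadicTerm hp h0 ha) _).trans (le_of_eq ?_)
    rw [← mul_assoc, ← ENNReal.ofReal_mul (by positivity), div_mul_cancel₀ _ (by positivity)]
  · refine (hup a f h0 ha hf).trans ?_
    refine (mul_le_mul_right (tsum_dyadicTerm_le_tsum hp h0 ha) _).trans (le_of_eq ?_)
    rw [← mul_assoc, ← ENNReal.ofReal_mul hC.le]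

theorem besovNorm_lt_top_iff {p : ℝ} (hp : 0 < p) (f : ℂ → ℂ) :
    besovNorm p f < ∞ ↔ besovRho p f ^ p < ∞ := by
  rw [besovNorm, ENNReal.rpow_lt_top_iff_of_pos (by positivity), ENNReal.add_lt_top]
  exact and_iff_right (ENNReal.rpow_lt_top_of_nonneg hp.le enorm_ne_top)

theorem mainTheorem8 (p : ℝ) (hp : 1 < p) :
    (∀ (a : ℕ → ℝ) (f : ℂ → ℂ),
      (∀ n, 0 ≤ a n) → Antitone a → Tendsto a atTop (𝓝 0) →
      (∀ z ∈ Metric.ball (0 : ℂ) 1, f z = ∑' n : ℕ, (a n : ℂ) * z ^ n) →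
        (MemBesov p f ↔
          Summable fun n : ℕ => ((n + 1 : ℕ) : ℝ) ^ (p - 1) * a (n + 1) ^ p)) ∧
    ∃ c C : ℝ, 0 < c ∧ 0 < C ∧
      ∀ (a : ℕ → ℝ) (f : ℂ → ℂ),
        (∀ n, 0 ≤ a n) → Antitone a → Tendsto a atTop (𝓝 0) →
        (∀ z ∈ Metric.ball (0 : ℂ) 1, f z = ∑' n : ℕ, (a n : ℂ) * z ^ n) →
          ENNReal.ofReal c *
              ∑' n : ℕ, ENNReal.ofReal (((n + 1 : ℕ) : ℝ) ^ (p - 1) * a (n + 1) ^ p)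
            ≤ besovRho p f ^ p ∧
          besovRho p f ^ p ≤
            ENNReal.ofReal C *
              ∑' n : ℕ, ENNReal.ofReal (((n + 1 : ℕ) : ℝ) ^ (p - 1) * a (n + 1) ^ p) := by
  obtain ⟨c, C, hc, hC, hbound⟩ := exists_besovRho_bounds hp
  refine ⟨fun a f h0 ha _ hf => ?_, c, C, hc, hC, fun a f h0 ha _ hf => hbound a f h0 ha hf⟩
  have hp0 : 0 < p := by linarith
  obtain ⟨hlow, hup⟩ := hbound a f h0 ha hf
  have hnn : ∀ n : ℕ, 0 ≤ ((n + 1 : ℕ) : ℝ) ^ (p - 1) * a (n + 1) ^ p := fun n => by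
    have := h0 (n + 1); positivity
  have hmem : MemBesov p f ↔ besovRho p f ^ p < ∞ := by
    rw [MemBesov, besovNorm_lt_top_iff hp0]
    exact and_iff_right
      ((differentiableOn_of_eq_tsum h0 ha hf).analyticOnNhd Metric.isOpen_ball)
  rw [hmem]
  constructor
  · intro h
    have h1 : ∑' n : ℕ, ENNReal.ofReal (((n + 1 : ℕ) : ℝ) ^ (p - 1) * a (n + 1) ^ p) ≠ ∞ := by
      intro htop
      rw [htop, ENNReal.mul_top (by simpa using hc)] at hlow
      exact absurd h (not_lt.2 hlow)
    exact (ENNReal.summable_toReal h1).congr fun n => ENNReal.toReal_ofReal (hnn n)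
  · intro h
    exact hup.trans_lt (ENNReal.mul_lt_top ENNReal.ofReal_lt_top h.tsum_ofReal_lt_top)
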